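/- Let $n\ge 1$ and let $0<k_1\le k_2\le\dots\le k_n$ be real numbers with $2m:=\sum_{i=1}^n k_i>1$. The configuration graph $C_{\mathbf k}$ is the weighted graph on the nodes $1,\dots,n$, without self-loops, in which any two distinct nodes $i,j$ are joined by a link of weight $c_{ij}=k_ik_j/(2m-1)$. Let $Q$ be its Laplacian ($Q_{ii}=\sum_{j\ne i}c_{ij}$ and $Q_{ij}=-c_{ij}$ for $i\neq j$), let $Q^\dagger$ be the Moore–Penrose pseudoinverse of $Q$, let $\omega_{ij}=(e_i-e_j)^TQ^\dagger(e_i-e_j)$ be the effective resistance, and $\Omega=(\omega_{ij})$. A maximum variance distribution is a maximizer $\mathbf p^\star$ of $\tfrac12\mathbf p^T\Omega\mathbf p$ over the probability simplex $\Delta_n=\{\mathbf p\in\mathbb R^n: p_i\ge 0,\ \sum_i p_i=1\}$. Then: 1. For all $i\ne j$, $\ \omega_{ij}=\frac{2m-1}{2m}\left(k_i^{-1}+k_j^{-1}\right)$. 2. There is exactly one maximum variance distribution $\mathbf p^\star$. Let $\mathcal V^\star_{\mathbf k}=\{i: p^\star_i>0\}$ be its support (the maximum variance support). 3. If $n\ge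 3$, there is exactly one $\ell\in\{3,\dots,n\}$ with $$k_\ell<\frac{1}{\ell-2}\sum_{i=1}^{\ell}k_i\le k_{\ell+1}\qquad(k_{n+1}:=\infty),$$ and for this $\ell$ the support $\mathcal V^\star_{\mathbf k}$ is the set $\{1,\dots,\ell\}$ of the $\ell$ nodes of smallest degree. 4. If $n\ge 3$, there is also exactly one $\ell\in\{3,\dots,n\}$ with $$k_\ell\le\frac{1}{\ell-2}\sum_{i=1}^{\ell}k_i< k_{\ell+1}\qquad(k_{n+1}:=\infty),$$ and for this $\ell$ the support $\mathcal V^\star_{\mathbf k}$ is the set of those nodes $i\le\ell$ with $k_i<\frac{1}{\ell-2}\sum_{j=1}^{\ell}k_j$; in particular it is $\{1,\dots,\ell\}$ unless $k_\ell=\frac{1}{\ell-2}\sum_{i=1}^{\ell}k_i$. 5. If $n\le 2$, then $\mathcal V^\star_{\mathbf k}=\{1,\dots,n\}$. -/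

import Mathlib

/-- `B` is a Moore–Penrose pseudoinverse of the real matrix `A`: the four Penrose conditions. -/
structure IsMoorePenroseInverse {ι : Type*} [Fintype ι] (A B : Matrix ι ι ℝ) : Prop where
  mul_mul_self : A * B * A = A
  self_mul_mul : B * A * B = B
  isSymm_mul : (A * B).IsSymm
  isSymm_mul' : (B * A).IsSymm

/-- A pseudoinverse of a real symmetric matrix, by diagonalization. -/
theorem exists_isMoorePenroseInverse_of_isHermitian {ι : Type*} [Fintype ι] [DecidableEq ι]
    (A : Matrix ι ι ℝ) (hA : A.IsHermitian) :
    ∃ B : Matrix ι ι ℝ, B.IsSymm ∧ IsMoorePenroseInverse A B := by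
  obtain ⟨U, d, hU, hAU⟩ : ∃ (U : Matrix ι ι ℝ) (d : ι → ℝ),
      U.transpose * U = 1 ∧ A = U * Matrix.diagonal d * U.transpose := by
    refine ⟨hA.eigenvectorUnitary, hA.eigenvalues, ?_, ?_⟩
    · have h := Unitary.coe_star_mul_self hA.eigenvectorUnitary
      simpa [Matrix.star_eq_conjTranspose, Matrix.conjTranspose_eq_transpose_of_trivial] using h
    · have h := hA.spectral_theorem
      rw [Unitary.conjStarAlgAut_apply] at h
      simpa [Matrix.star_eq_conjTranspose, Matrix.conjTranspose_eq_transpose_of_trivial,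
        Function.comp_def] using h
  have key : ∀ a b : ι → ℝ, U * Matrix.diagonal a * U.transpose *
      (U * Matrix.diagonal b * U.transpose) =
        U * Matrix.diagonal (fun i => a i * b i) * U.transpose := by
    intro a b
    calc _ = U * Matrix.diagonal a * (U.transpose * U) * Matrix.diagonal b * U.transpose := by
          simp only [Matrix.mul_assoc]
      _ = _ := by
          rw [hU, Matrix.mul_one, Matrix.mul_assoc U, Matrix.diagonal_mul_diagonal]
  have symm : ∀ a : ι → ℝ, (U * Matrix.diagonal a * U.transpose).IsSymm := by
    intro a
    simp [Matrix.IsSymm, Matrix.transpose_mul, Matrix.mul_assoc]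
  refine ⟨U * Matrix.diagonal (fun i => (d i)⁻¹) * U.transpose, symm _, ?_, ?_, ?_, ?_⟩
  · rw [hAU, key, key]
    simp
  · rw [hAU, key, key]
    congr 3
    ext i
    by_cases h : d i = 0 <;> simp [h]
  · rw [hAU, key]; exact symm _
  · rw [hAU, key]; exact symm _

theorem exists_isMoorePenroseInverse {ι : Type*} [Fintype ι] (A : Matrix ι ι ℝ) :
    ∃ B : Matrix ι ι ℝ, IsMoorePenroseInverse A B := by
  classical
  have hH : (A.transpose * A).IsHermitian := by
    simp [Matrix.IsHermitian, Matrix.conjTranspose_eq_transpose_of_trivial]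
  obtain ⟨G, hG, h1, h2, h3, h4⟩ := exists_isMoorePenroseInverse_of_isHermitian _ hH
  have hGA : A * (G * (A.transpose * A)) = A := by
    have h0 : (A * (G * (A.transpose * A) - 1)).conjTranspose *
        (A * (G * (A.transpose * A) - 1)) = 0 := by
      rw [Matrix.conjTranspose_eq_transpose_of_trivial, Matrix.transpose_mul]
      have e : A.transpose * (A * (G * (A.transpose * A) - 1)) = 0 := by
        rw [← Matrix.mul_assoc, Matrix.mul_sub, ← Matrix.mul_assoc, h1, Matrix.mul_one, sub_self]
      rw [Matrix.mul_assoc, e, Matrix.mul_zero]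
    rw [Matrix.conjTranspose_mul_self_eq_zero, Matrix.mul_sub, Matrix.mul_one, sub_eq_zero] at h0
    exact h0
  refine ⟨G * A.transpose, ?_, ?_, ?_, ?_⟩
  · simpa [Matrix.mul_assoc] using hGA
  · calc G * A.transpose * A * (G * A.transpose)
        = G * (A.transpose * A) * G * A.transpose := by simp only [Matrix.mul_assoc]
      _ = G * A.transpose := by rw [h2]
  · simp [Matrix.IsSymm, Matrix.transpose_mul, Matrix.mul_assoc, hG.eq]
  · simpa [Matrix.mul_assoc] using h4

theorem IsMoorePenroseInverse.eq {ι : Type*} [Fintype ι] {A B C : Matrix ι ι ℝ}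
    (hB : IsMoorePenroseInverse A B) (hC : IsMoorePenroseInverse A C) : B = C := by
  have h1 : A * B = A * C := by
    calc A * B = (A * C) * (A * B) := by rw [← Matrix.mul_assoc, hC.mul_mul_self]
      _ = (A * C).transpose * (A * B).transpose := by rw [hC.isSymm_mul.eq, hB.isSymm_mul.eq]
      _ = (A * B * A * C).transpose := by rw [← Matrix.transpose_mul]; simp only [Matrix.mul_assoc]
      _ = A * C := by rw [hB.mul_mul_self, hC.isSymm_mul.eq]
  have h2 : B * A = C * A := by
    calc B * A = (B * A) * (C * A) := by
          rw [Matrix.mul_assoc, ← Matrix.mul_assoc A, hC.mul_mul_self]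
      _ = (B * A).transpose * (C * A).transpose := by rw [hC.isSymm_mul'.eq, hB.isSymm_mul'.eq]
      _ = (C * (A * B * A)).transpose := by
          rw [← Matrix.transpose_mul]; simp only [Matrix.mul_assoc]
      _ = C * A := by rw [hB.mul_mul_self, hC.isSymm_mul'.eq]
  calc B = B * A * B := hB.self_mul_mul.symm
    _ = C * A * C := by rw [Matrix.mul_assoc, h1, ← Matrix.mul_assoc, h2]
    _ = C := hC.self_mul_mul

/-- The Moore–Penrose pseudoinverse `A†` of a real square matrix. -/
noncomputable def moorePenrose {ι : Type*} [Fintype ι] (A : Matrix ι ι ℝ) : Matrix ι ι ℝ :=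
  Classical.choose (exists_isMoorePenroseInverse A)

theorem moorePenrose_spec {ι : Type*} [Fintype ι] (A : Matrix ι ι ℝ) :
    IsMoorePenroseInverse A (moorePenrose A) :=
  Classical.choose_spec (exists_isMoorePenroseInverse A)

/-- The Laplacian of the weighted graph with (symmetric, zero-diagonal) matrix of link weights `c`:
the weighted degrees `∑ j, c i j` on the diagonal and `-c i j` off the diagonal. -/
noncomputable def weightedLaplacian {ι : Type*} [Fintype ι] [DecidableEq ι] (c : Matrix ι ι ℝ) :
    Matrix ι ι ℝ :=
  Matrix.diagonal (fun i => ∑ j, c i j) - c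

/-- The effective resistance `ω i j = (e i - e j)ᵀ Q† (e i - e j)`, where `Q` is the Laplacian. -/
noncomputable def effectiveResistance {ι : Type*} [Fintype ι] [DecidableEq ι] (c : Matrix ι ι ℝ)
    (i j : ι) : ℝ :=
  (Pi.single i 1 - Pi.single j 1 : ι → ℝ) ⬝ᵥ
    (moorePenrose (weightedLaplacian c)).mulVec (Pi.single i 1 - Pi.single j 1)

/-- The variance `(1/2) pᵀ Ω p` of a distribution `p` on the nodes, with respect to the square root
of the effective resistance. -/
noncomputable def graphVariance {ι : Type*} [Fintype ι] [DecidableEq ι] (c : Matrix ι ι ℝ)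
    (p : ι → ℝ) : ℝ :=
  (1 / 2) * (p ⬝ᵥ (Matrix.of (effectiveResistance c)).mulVec p)

/-- `p` solves the maximum variance problem: it maximizes the variance over the probability
simplex. -/
def IsMaxVarianceDistribution {ι : Type*} [Fintype ι] [DecidableEq ι] (c : Matrix ι ι ℝ)
    (p : ι → ℝ) : Prop :=
  p ∈ stdSimplex ℝ ι ∧ ∀ q ∈ stdSimplex ℝ ι, graphVariance c q ≤ graphVariance c p

/-- The link weights of the configuration graph with degree sequence `k`: between distinct nodes
`i` and `j` the weight is `k i * k j / (2m - 1)`, where `2m = ∑ r, k r`; there are no self-loops. -/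
noncomputable def configurationWeights {ι : Type*} [Fintype ι] [DecidableEq ι] (k : ι → ℝ) :
    Matrix ι ι ℝ :=
  Matrix.of fun i j => if i = j then 0 else k i * k j / ((∑ r, k r) - 1)

/-- `(ℓ - 2)⁻¹ ∑_{i=1}^ℓ k_i`. The index `i : Fin n` stands for the node numbered `i + 1`. -/
noncomputable def degreeThreshold {n : ℕ} (k : Fin n → ℝ) (ℓ : ℕ) : ℝ :=
  ((ℓ : ℝ) - 2)⁻¹ * ∑ i ∈ Finset.univ.filter (fun i : Fin n => (i : ℕ) < ℓ), k i

/-- `3 ≤ ℓ ≤ n` and `k_ℓ < (ℓ - 2)⁻¹ ∑_{i=1}^ℓ k_i ≤ k_{ℓ+1}`, where `k_{n+1} = ∞`. -/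
def SupportCriterion {n : ℕ} (k : Fin n → ℝ) (ℓ : ℕ) : Prop :=
  3 ≤ ℓ ∧ ℓ ≤ n ∧ (∀ i : Fin n, (i : ℕ) + 1 = ℓ → k i < degreeThreshold k ℓ) ∧
    ∀ i : Fin n, (i : ℕ) = ℓ → degreeThreshold k ℓ ≤ k i

/-- `3 ≤ ℓ ≤ n` and `k_ℓ ≤ (ℓ - 2)⁻¹ ∑_{i=1}^ℓ k_i < k_{ℓ+1}`, where `k_{n+1} = ∞`. -/
def SupportCriterion' {n : ℕ} (k : Fin n → ℝ) (ℓ : ℕ) : Prop :=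
  3 ≤ ℓ ∧ ℓ ≤ n ∧ (∀ i : Fin n, (i : ℕ) + 1 = ℓ → k i ≤ degreeThreshold k ℓ) ∧
    ∀ i : Fin n, (i : ℕ) = ℓ → degreeThreshold k ℓ < k i

/-! With `S = 2m`, the Laplacian is `(S diag(k) - k kᵀ)/(S - 1)`, so on vectors orthogonal to `k` it
acts as a diagonal matrix. Hence `Q y = e_i - e_j` is solved by hand, and a solution is all that the
effective resistance needs. As `ω i j` is a sum of a term in `i` and a term in `j`, the variance on
the simplex is a positive multiple of the separable, strictly concave `∑ (p_i - p_i²)/k_i`.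

The optimality conditions give `p_i = max(0, 1 - t k_i)/2`, where the multiplier `t` is fixed by `∑
max(0, 1 - t k_i) = 2`. The support is `{i | t k_i < 1}`. If the nonzero terms lie among the first
`ℓ` nodes and the inequalities `t k_i ≤ 1` hold there, the equation reads `ℓ - t ∑_{i ≤ ℓ} k_i = 2`;
for `n ≥ 3`, `t > 0` and `1/t` is the degree threshold at `ℓ`. The two criteria cut the nodes by `t
k_i < 1` and by `t k_i ≤ 1`; `supportCriterion_iff` and `supportCriterion'_iff` say so. -/

/-! ### Effective resistances of the configuration graph. -/

theorem weightedLaplacian_configurationWeights_mulVec {ι : Type*} [Fintype ι] [DecidableEq ι]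
    (k : ι → ℝ) (v : ι → ℝ) (i : ι) :
    (weightedLaplacian (configurationWeights k)).mulVec v i =
      k i * ((∑ r, k r) * v i - ∑ r, k r * v r) / ((∑ r, k r) - 1) := by
  have h : ∀ w : ι → ℝ, ∑ j, configurationWeights k i j * w j =
      k i * ((∑ r, k r * w r) - k i * w i) / ((∑ r, k r) - 1) := by
    intro w
    have h1 : ∀ j, configurationWeights k i j * w j =
        k i / ((∑ r, k r) - 1) * (k j * w j - if i = j then k i * w i else 0) := by
      intro j
      by_cases hij : i = j
      · subst hij; simp [configurationWeights]
      · simp only [configurationWeights, Matrix.of_apply, if_neg hij]; ring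
    rw [Finset.sum_congr rfl fun j _ => h1 j, ← Finset.mul_sum, Finset.sum_sub_distrib]
    simp only [Finset.sum_ite_eq, Finset.mem_univ, if_true]
    ring
  -- The constant vector gives the row sum, which is the diagonal entry of the Laplacian.
  have h1 := h 1
  simp only [Pi.one_apply, mul_one] at h1
  rw [weightedLaplacian, Matrix.sub_mulVec, Pi.sub_apply, Matrix.mulVec_diagonal, h1,
    Matrix.mulVec, dotProduct, h v]
  ring

theorem isSymm_weightedLaplacian_configurationWeights {ι : Type*} [Fintype ι] [DecidableEq ι]
    (k : ι → ℝ) : (weightedLaplacian (configurationWeights k)).IsSymm := by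
  have h : (configurationWeights k).IsSymm := by
    ext i j
    by_cases hij : i = j
    · subst hij; rfl
    · simp [configurationWeights, hij, Ne.symm hij, mul_comm]
  rw [weightedLaplacian, Matrix.IsSymm, Matrix.transpose_sub, h.eq, Matrix.diagonal_transpose]

theorem effectiveResistance_self {ι : Type*} [Fintype ι] [DecidableEq ι] (c : Matrix ι ι ℝ)
    (i : ι) : effectiveResistance c i i = 0 := by
  simp [effectiveResistance]

/-- A vector in the range of a symmetric matrix `A` has quadratic form `xᵀ A† x = xᵀ y` for any
solution `y` of `A y = x`. -/
theorem dotProduct_moorePenrose_mulVec {ι : Type*} [Fintype ι] {A : Matrix ι ι ℝ}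
    (hA : A.IsSymm) {x y : ι → ℝ} (h : A.mulVec y = x) :
    x ⬝ᵥ (moorePenrose A).mulVec x = x ⬝ᵥ y := by
  subst h
  have hx : A.mulVec y = Matrix.vecMul y A := by rw [← Matrix.mulVec_transpose, hA.eq]
  calc A.mulVec y ⬝ᵥ (moorePenrose A).mulVec (A.mulVec y)
      = Matrix.vecMul y A ⬝ᵥ (moorePenrose A).mulVec (A.mulVec y) := by rw [← hx]
    _ = y ⬝ᵥ (A * moorePenrose A * A).mulVec y := by
        simp only [← Matrix.dotProduct_mulVec, Matrix.mulVec_mulVec, Matrix.mul_assoc]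
    _ = A.mulVec y ⬝ᵥ y := by
        rw [(moorePenrose_spec A).mul_mul_self, dotProduct_comm]

theorem effectiveResistance_configurationWeights {ι : Type*} [Fintype ι] [DecidableEq ι]
    {k : ι → ℝ} (hpos : ∀ i, 0 < k i) (hm : 1 < ∑ i, k i) {i j : ι} (hij : i ≠ j) :
    effectiveResistance (configurationWeights k) i j =
      ((∑ r, k r) - 1) / (∑ r, k r) * ((k i)⁻¹ + (k j)⁻¹) := by
  set S := ∑ r, k r with hS
  have hS0 : S ≠ 0 := by linarith
  have hD0 : S - 1 ≠ 0 := by linarith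
  have hk : ∀ r, k r ≠ 0 := fun r => (hpos r).ne'
  set x : ι → ℝ := Pi.single i 1 - Pi.single j 1 with hx
  have hsum : ∑ r, x r = 0 := by simp [hx]
  -- On vectors orthogonal to `k` the Laplacian multiplies entry `r` by `S k_r / (S - 1)`; `y`
  -- inverts this, and it is orthogonal to `k` because `x` sums to zero.
  set y : ι → ℝ := fun r => (S - 1) / S * (k r)⁻¹ * x r with hy
  have hky : ∑ r, k r * y r = 0 := by
    rw [← mul_zero ((S - 1) / S), ← hsum, Finset.mul_sum]
    refine Finset.sum_congr rfl fun r _ => ?_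
    have := hk r
    simp only [hy]; field_simp
  have hQ : (weightedLaplacian (configurationWeights k)).mulVec y = x := by
    ext r
    rw [weightedLaplacian_configurationWeights_mulVec, hky, ← hS]
    have := hk r
    simp only [hy]; field_simp; ring
  rw [effectiveResistance, ← hx,
    dotProduct_moorePenrose_mulVec (isSymm_weightedLaplacian_configurationWeights k) hQ,
    hx, sub_dotProduct, single_one_dotProduct, single_one_dotProduct]
  simp [hy, hx, hij, Ne.symm hij]
  ring

/-! ### The variance and its unique maximizer. -/

/-- The variance on the configuration graph is a separable concave quadratic function. -/
theorem graphVariance_configurationWeights {ι : Type*} [Fintype ι] [DecidableEq ι]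
    {k : ι → ℝ} (hpos : ∀ i, 0 < k i) (hm : 1 < ∑ i, k i) {p : ι → ℝ} (hp : ∑ i, p i = 1) :
    graphVariance (configurationWeights k) p =
      ((∑ r, k r) - 1) / (∑ r, k r) * ∑ i, (k i)⁻¹ * (p i - p i ^ 2) := by
  set a := ((∑ r, k r) - 1) / (∑ r, k r) with ha
  -- The off-diagonal formula would give `2a/k_i` on the diagonal instead of `0`; the correction is
  -- the source of the `-p_i²` terms.
  have hω : ∀ i j, effectiveResistance (configurationWeights k) i j =
      a * ((k i)⁻¹ + (k j)⁻¹) - if i = j then 2 * a * (k i)⁻¹ else 0 := by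
    intro i j
    by_cases hij : i = j
    · subst hij; rw [effectiveResistance_self]; simp; ring
    · rw [effectiveResistance_configurationWeights hpos hm hij, if_neg hij, sub_zero]
  have hrow : ∀ i, p i * ∑ j, effectiveResistance (configurationWeights k) i j * p j =
      a * ((k i)⁻¹ * p i) + a * (∑ j, (k j)⁻¹ * p j) * p i
        - 2 * a * ((k i)⁻¹ * p i ^ 2) := by
    intro i
    have : ∀ j, effectiveResistance (configurationWeights k) i j * p j =
        a * (k i)⁻¹ * p j + a * ((k j)⁻¹ * p j) -
          if i = j then 2 * a * (k i)⁻¹ * p i else 0 := by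
      intro j
      rw [hω]
      by_cases hij : i = j
      · subst hij; simp; ring
      · simp only [if_neg hij]; ring
    rw [Finset.sum_congr rfl fun j _ => this j, Finset.sum_sub_distrib, Finset.sum_add_distrib,
      ← Finset.mul_sum, ← Finset.mul_sum, hp]
    simp only [Finset.sum_ite_eq, Finset.mem_univ, if_true]
    ring
  have : p ⬝ᵥ (Matrix.of (effectiveResistance (configurationWeights k))).mulVec p =
      ∑ i, p i * ∑ j, effectiveResistance (configurationWeights k) i j * p j := rfl
  rw [graphVariance, this, Finset.sum_congr rfl fun i _ => hrow i, Finset.sum_sub_distrib,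
    Finset.sum_add_distrib, ← Finset.mul_sum, ← Finset.mul_sum, ← Finset.mul_sum, hp]
  simp only [mul_sub, Finset.sum_sub_distrib]
  ring

/-- The distribution with Lagrange multiplier `t` in the maximum variance problem on the
configuration graph. -/
noncomputable def thresholdDistribution {ι : Type*} (k : ι → ℝ) (t : ℝ) (i : ι) : ℝ :=
  max 0 (1 - t * k i) / 2

theorem thresholdDistribution_pos_iff {ι : Type*} {k : ι → ℝ} {t : ℝ} {i : ι} :
    0 < thresholdDistribution k t i ↔ t * k i < 1 := by
  rw [thresholdDistribution, div_pos_iff_of_pos_right two_pos, lt_max_iff, sub_pos]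
  simp

theorem thresholdDistribution_mem_stdSimplex {ι : Type*} [Fintype ι] {k : ι → ℝ} {t : ℝ}
    (ht : ∑ i, max 0 (1 - t * k i) = 2) : thresholdDistribution k t ∈ stdSimplex ℝ ι := by
  refine ⟨fun i => div_nonneg (le_max_left _ _) zero_le_two, ?_⟩
  simp only [thresholdDistribution]
  rw [← Finset.sum_div, ht, div_self two_ne_zero]

/-- Quantitative optimality of `thresholdDistribution`. -/
theorem sum_le_sum_thresholdDistribution_sub {ι : Type*} [Fintype ι] {k : ι → ℝ}
    (hpos : ∀ i, 0 < k i) {t : ℝ} (ht : ∑ i, max 0 (1 - t * k i) = 2) {q : ι → ℝ}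
    (hq : q ∈ stdSimplex ℝ ι) :
    ∑ i, (k i)⁻¹ * (q i - q i ^ 2) ≤
      ∑ i, (k i)⁻¹ * (thresholdDistribution k t i - thresholdDistribution k t i ^ 2) -
        ∑ i, (k i)⁻¹ * (q i - thresholdDistribution k t i) ^ 2 := by
  have hp := thresholdDistribution_mem_stdSimplex ht
  set p := thresholdDistribution k t with hpdef
  -- Both vectors have total mass 1, so adding this null sum reduces the claim to a termwise
  -- inequality.
  have h0 : ∑ i, t * (q i - p i) = 0 := by
    rw [← Finset.mul_sum, Finset.sum_sub_distrib, hq.2, hp.2, sub_self, mul_zero]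
  rw [← Finset.sum_sub_distrib, ← add_zero (∑ i, (_ - _)), ← h0, ← Finset.sum_add_distrib]
  refine Finset.sum_le_sum fun i _ => ?_
  -- First-order condition: the derivative `(1 - 2 p_i)/k_i` equals `t` where `1 - t k_i ≥ 0`, and
  -- is at most `t` where `p_i = 0`. The second-order expansion is exact, which produces the square
  -- term.
  have key : (k i)⁻¹ * ((1 - 2 * p i) * (q i - p i)) ≤ t * (q i - p i) := by
    rw [inv_mul_le_iff₀ (hpos i)]
    rcases le_total (1 - t * k i) 0 with h | h
    · have hpi : p i = 0 := by simp [hpdef, thresholdDistribution, max_eq_left h]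
      rw [hpi]
      nlinarith [mul_nonneg (sub_nonneg.2 (sub_nonpos.1 h)) (hq.1 i)]
    · have hpi : p i = (1 - t * k i) / 2 := by
        simp [hpdef, thresholdDistribution, max_eq_right h]
      rw [hpi]; apply le_of_eq; ring
  linarith

theorem isMaxVarianceDistribution_thresholdDistribution {ι : Type*} [Fintype ι] [DecidableEq ι]
    {k : ι → ℝ} (hpos : ∀ i, 0 < k i) (hm : 1 < ∑ i, k i) {t : ℝ}
    (ht : ∑ i, max 0 (1 - t * k i) = 2) :
    IsMaxVarianceDistribution (configurationWeights k) (thresholdDistribution k t) := by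
  have hp := thresholdDistribution_mem_stdSimplex ht
  refine ⟨hp, fun q hq => ?_⟩
  rw [graphVariance_configurationWeights hpos hm hq.2,
    graphVariance_configurationWeights hpos hm hp.2]
  refine mul_le_mul_of_nonneg_left ?_ (div_nonneg (by linarith) (by linarith))
  have h1 := sum_le_sum_thresholdDistribution_sub hpos ht hq
  have h2 : 0 ≤ ∑ i, (k i)⁻¹ * (q i - thresholdDistribution k t i) ^ 2 :=
    Finset.sum_nonneg fun i _ => mul_nonneg (inv_nonneg.2 (hpos i).le) (sq_nonneg _)
  linarith

/-- The quadratic gap in `sum_le_sum_thresholdDistribution_sub` must vanish at any other maximizer.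
-/
theorem IsMaxVarianceDistribution.eq_thresholdDistribution {ι : Type*} [Fintype ι]
    [DecidableEq ι] {k : ι → ℝ} (hpos : ∀ i, 0 < k i) (hm : 1 < ∑ i, k i) {t : ℝ}
    (ht : ∑ i, max 0 (1 - t * k i) = 2) {q : ι → ℝ}
    (hq : IsMaxVarianceDistribution (configurationWeights k) q) :
    q = thresholdDistribution k t := by
  have hp := thresholdDistribution_mem_stdSimplex ht
  have hle := hq.2 _ hp
  rw [graphVariance_configurationWeights hpos hm hq.1.2,
    graphVariance_configurationWeights hpos hm hp.2] at hle
  have hle' := le_of_mul_le_mul_left hle (div_pos (by linarith) (by linarith))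
  have h1 := sum_le_sum_thresholdDistribution_sub hpos ht hq.1
  have hnn : ∀ i, 0 ≤ (k i)⁻¹ * (q i - thresholdDistribution k t i) ^ 2 :=
    fun i => mul_nonneg (inv_nonneg.2 (hpos i).le) (sq_nonneg _)
  have h2 : ∑ i, (k i)⁻¹ * (q i - thresholdDistribution k t i) ^ 2 = 0 :=
    le_antisymm (by linarith) (Finset.sum_nonneg fun i _ => hnn i)
  rw [Finset.sum_eq_zero_iff_of_nonneg fun i _ => hnn i] at h2
  ext i
  have h3 := h2 i (Finset.mem_univ i)
  rw [mul_eq_zero, or_iff_right (inv_ne_zero (hpos i).ne'), sq_eq_zero_iff, sub_eq_zero] at h3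
  exact h3

/-! ### The equation for the multiplier `t`. -/

/-- Intermediate values between `±1/min k`: at the positive end all terms vanish, at the negative
end the smallest degree alone contributes 2. Negative `t` is needed for a single node, where `t =
-1/k`. -/
theorem exists_sum_max_eq_two {ι : Type*} [Fintype ι] [Nonempty ι] {k : ι → ℝ}
    (hpos : ∀ i, 0 < k i) : ∃ t : ℝ, ∑ i, max 0 (1 - t * k i) = 2 := by
  obtain ⟨i₀, hi₀⟩ := Finite.exists_min k
  have hc : Continuous fun t : ℝ => ∑ i, max 0 (1 - t * k i) := by fun_prop
  have h1 : 2 ≤ ∑ i, max 0 (1 - (-(k i₀)⁻¹) * k i) := by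
    refine le_trans ?_ (Finset.single_le_sum (f := fun i => max 0 (1 - (-(k i₀)⁻¹) * k i))
      (fun i _ => le_max_left _ _) (Finset.mem_univ i₀))
    refine le_trans (le_of_eq ?_) (le_max_right _ _)
    rw [neg_mul, inv_mul_cancel₀ (hpos i₀).ne']; norm_num
  have h2 : ∑ i, max 0 (1 - (k i₀)⁻¹ * k i) ≤ 2 := by
    rw [Finset.sum_eq_zero]
    · norm_num
    · intro i _
      rw [max_eq_left]
      rw [sub_nonpos, inv_mul_eq_div, one_le_div (hpos i₀)]
      exact hi₀ i
  obtain ⟨t, ht⟩ := mem_range_of_exists_le_of_exists_ge hc ⟨_, h2⟩ ⟨_, h1⟩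
  exact ⟨t, ht⟩

/-- For `t ≤ 0` each of the at least three terms is at least 1. -/
theorem pos_of_sum_max_eq_two {ι : Type*} [Fintype ι] {k : ι → ℝ} (hpos : ∀ i, 0 < k i) {t : ℝ}
    (ht : ∑ i, max 0 (1 - t * k i) = 2) (hn : 3 ≤ Fintype.card ι) : 0 < t := by
  by_contra! h
  have : ∑ _i : ι, (1 : ℝ) ≤ ∑ i, max 0 (1 - t * k i) := by
    refine Finset.sum_le_sum fun i _ => le_trans ?_ (le_max_right _ _)
    nlinarith [mul_nonneg (neg_nonneg.2 h) (hpos i).le]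
  rw [ht] at this
  simp only [Finset.sum_const, Finset.card_univ, nsmul_eq_mul, mul_one] at this
  have h3 : (3 : ℝ) ≤ Fintype.card ι := by exact_mod_cast hn
  linarith

/-- If `t k_i ≥ 1` for some `i`, then `t > 0`, so each of the at most two terms is below 1. -/
theorem mul_lt_one_of_sum_max_eq_two {ι : Type*} [Fintype ι] {k : ι → ℝ} (hpos : ∀ i, 0 < k i)
    {t : ℝ} (ht : ∑ i, max 0 (1 - t * k i) = 2) (hn : Fintype.card ι ≤ 2) (i : ι) :
    t * k i < 1 := by
  by_contra! h
  have ht0 : 0 < t := pos_of_mul_pos_left (one_pos.trans_le h) (hpos i).le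
  have : ∑ i, max 0 (1 - t * k i) < ∑ _i : ι, (1 : ℝ) := by
    refine Finset.sum_lt_sum_of_nonempty ⟨i, Finset.mem_univ i⟩ fun j _ => max_lt one_pos ?_
    linarith [mul_pos ht0 (hpos j)]
  rw [ht] at this
  simp only [Finset.sum_const, Finset.card_univ, nsmul_eq_mul, mul_one] at this
  have h3 : (Fintype.card ι : ℝ) ≤ 2 := by exact_mod_cast hn
  linarith

/-- Both multipliers yield the unique maximizer, and `t` can be read off at any node of positive
mass. -/
theorem sum_max_injective {ι : Type*} [Fintype ι] [DecidableEq ι] {k : ι → ℝ}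
    (hpos : ∀ i, 0 < k i) (hm : 1 < ∑ i, k i) {t u : ℝ}
    (ht : ∑ i, max 0 (1 - t * k i) = 2) (hu : ∑ i, max 0 (1 - u * k i) = 2) : t = u := by
  have h := (isMaxVarianceDistribution_thresholdDistribution hpos hm ht).eq_thresholdDistribution
    hpos hm hu
  obtain ⟨i, hi⟩ : ∃ i, t * k i < 1 := by
    by_contra! h
    rw [Finset.sum_eq_zero fun i _ => max_eq_left (sub_nonpos.2 (h i))] at ht
    norm_num at ht
  have hi' : u * k i < 1 := by
    rw [← thresholdDistribution_pos_iff, ← h, thresholdDistribution_pos_iff]; exact hi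
  have h' := congrFun h i
  rw [thresholdDistribution, thresholdDistribution, max_eq_right (by linarith),
    max_eq_right (by linarith)] at h'
  exact mul_right_cancel₀ (hpos i).ne' (by linarith)

/-! ### Multipliers as inverse degree thresholds. -/

/-- A node with `t k_i = 1` contributes zero, so it may lie on either side of the cut. The
non-strict bounds let this serve both criteria. -/
theorem sum_max_of_threshold {n : ℕ} {k : Fin n → ℝ} {t : ℝ} {ℓ : ℕ} (hℓ : ℓ ≤ n)
    (h1 : ∀ i : Fin n, (i : ℕ) < ℓ → t * k i ≤ 1) (h2 : ∀ i : Fin n, ℓ ≤ (i : ℕ) → 1 ≤ t * k i) :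
    ∑ i, max 0 (1 - t * k i) =
      ℓ - t * ∑ i ∈ Finset.univ.filter (fun i : Fin n => (i : ℕ) < ℓ), k i := by
  have hcard : (Finset.univ.filter (fun i : Fin n => (i : ℕ) < ℓ)).card = ℓ := by
    rw [Fin.card_filter_val_lt, min_eq_right hℓ]
  have : ∀ i : Fin n, max 0 (1 - t * k i) = if (i : ℕ) < ℓ then 1 - t * k i else 0 := by
    intro i
    split_ifs with h
    · exact max_eq_right (sub_nonneg.2 (h1 i h))
    · exact max_eq_left (sub_nonpos.2 (h2 i (not_lt.1 h)))
  rw [Finset.sum_congr rfl fun i _ => this i, ← Finset.sum_filter, Finset.sum_sub_distrib,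
    ← Finset.mul_sum, Finset.sum_const, hcard, nsmul_eq_mul, mul_one]

theorem sum_filter_val_lt_pos {n : ℕ} {k : Fin n → ℝ} (hpos : ∀ i, 0 < k i) {ℓ : ℕ} (h0 : 0 < ℓ)
    (hℓ : ℓ ≤ n) : 0 < ∑ i ∈ Finset.univ.filter (fun i : Fin n => (i : ℕ) < ℓ), k i :=
  Finset.sum_pos (fun i _ => hpos i) ⟨⟨0, h0.trans_le hℓ⟩, by simpa using h0⟩

theorem degreeThreshold_pos {n : ℕ} {k : Fin n → ℝ} (hpos : ∀ i, 0 < k i) {ℓ : ℕ} (h3 : 3 ≤ ℓ)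
    (hℓ : ℓ ≤ n) : 0 < degreeThreshold k ℓ := by
  have : (3 : ℝ) ≤ ℓ := by exact_mod_cast h3
  exact mul_pos (inv_pos.2 (by linarith)) (sum_filter_val_lt_pos hpos (by omega) hℓ)

/-- A cut at the threshold solves the normalization equation. -/
theorem sum_max_inv_degreeThreshold {n : ℕ} {k : Fin n → ℝ} (hpos : ∀ i, 0 < k i) {ℓ : ℕ}
    (h3 : 3 ≤ ℓ) (hℓ : ℓ ≤ n) (h1 : ∀ i : Fin n, (i : ℕ) < ℓ → k i ≤ degreeThreshold k ℓ)
    (h2 : ∀ i : Fin n, ℓ ≤ (i : ℕ) → degreeThreshold k ℓ ≤ k i) :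
    ∑ i, max 0 (1 - (degreeThreshold k ℓ)⁻¹ * k i) = 2 := by
  have hT := degreeThreshold_pos hpos h3 hℓ
  have hs := sum_filter_val_lt_pos hpos (by omega) hℓ
  have h3' : (3 : ℝ) ≤ ℓ := by exact_mod_cast h3
  rw [sum_max_of_threshold hℓ
    (fun i hi => by rw [inv_mul_le_one₀ hT]; exact h1 i hi)
    (fun i hi => by rw [inv_mul_eq_div, one_le_div hT]; exact h2 i hi)]
  rw [degreeThreshold, mul_inv, inv_inv, mul_assoc, inv_mul_cancel₀ hs.ne']
  ring

/-- Conversely, a solution of the normalization equation is the threshold at its cut. -/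
theorem degreeThreshold_eq_inv {n : ℕ} {k : Fin n → ℝ} (hpos : ∀ i, 0 < k i) {t : ℝ}
    (ht0 : 0 < t) (ht : ∑ i, max 0 (1 - t * k i) = 2) {ℓ : ℕ} (hℓ : ℓ ≤ n)
    (h1 : ∀ i : Fin n, (i : ℕ) < ℓ → t * k i ≤ 1)
    (h2 : ∀ i : Fin n, ℓ ≤ (i : ℕ) → 1 ≤ t * k i) :
    3 ≤ ℓ ∧ degreeThreshold k ℓ = t⁻¹ := by
  rw [sum_max_of_threshold hℓ h1 h2] at ht
  have h0 : 0 < ℓ := by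
    rcases Nat.eq_zero_or_pos ℓ with h | h
    · subst h; norm_num at ht
    · exact h
  have hs := sum_filter_val_lt_pos hpos h0 hℓ
  -- The equation gives `ℓ - 2 = t ∑ k_i > 0`, hence the lower bound 3 on `ℓ`.
  have h2ℓ : (2 : ℝ) < ℓ := by linarith [mul_pos ht0 hs]
  refine ⟨by exact_mod_cast h2ℓ, ?_⟩
  have he : (ℓ : ℝ) - 2 =
      t * ∑ i ∈ Finset.univ.filter (fun i : Fin n => (i : ℕ) < ℓ), k i := by linarith
  rw [degreeThreshold, he, mul_inv, mul_assoc, inv_mul_cancel₀ hs.ne', mul_one]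

/-- A down-closed predicate on `Fin n` is an initial segment. -/
theorem exists_iff_val_lt_of_down_closed {n : ℕ} (P : Fin n → Prop)
    (hP : ∀ i j, i ≤ j → P j → P i) : ∃ ℓ ≤ n, ∀ i : Fin n, P i ↔ (i : ℕ) < ℓ := by
  classical
  have hex : ∃ ℓ, ∀ i : Fin n, ℓ ≤ (i : ℕ) → ¬ P i := ⟨n, fun i hi => absurd i.2 (not_lt.2 hi)⟩
  refine ⟨Nat.find hex, Nat.find_min' hex fun i hi => absurd i.2 (not_lt.2 hi), fun i => ?_⟩
  constructor
  · intro hi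
    by_contra! h
    exact Nat.find_spec hex i h hi
  · intro hi
    have := Nat.find_min hex hi
    push Not at this
    obtain ⟨j, hij, hj⟩ := this
    exact hP i j hij hj

theorem eq_of_forall_val_lt_iff {n ℓ ℓ' : ℕ} (hℓ : ℓ ≤ n) (hℓ' : ℓ' ≤ n)
    (h : ∀ i : Fin n, (i : ℕ) < ℓ ↔ (i : ℕ) < ℓ') : ℓ = ℓ' := by
  rcases lt_trichotomy ℓ ℓ' with hlt | heq | hlt
  · exact absurd ((h ⟨ℓ, by omega⟩).2 hlt) (lt_irrefl _)
  · exact heq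
  · exact absurd ((h ⟨ℓ', by omega⟩).1 hlt) (lt_irrefl _)

/-! ### The two support criteria. -/

/-- Monotonicity spreads the inequalities at the cut to all nodes; the last node before the cut has
index `ℓ - 1`, and the first one after it, if any, has index `ℓ`. -/
theorem SupportCriterion.lt_iff {n : ℕ} {k : Fin n → ℝ} (hmono : Monotone k) {ℓ : ℕ}
    (h : SupportCriterion k ℓ) (i : Fin n) : (i : ℕ) < ℓ ↔ k i < degreeThreshold k ℓ := by
  obtain ⟨h3, hn, h1, h2⟩ := h
  constructor
  · intro hi
    exact (hmono (show i ≤ ⟨ℓ - 1, by omega⟩ from Fin.le_def.2 (Nat.le_sub_one_of_lt hi))).trans_lt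
      (h1 ⟨ℓ - 1, by omega⟩ (Nat.sub_add_cancel (by omega)))
  · intro hi
    by_contra! hℓ
    exact absurd hi (not_lt.2 ((h2 ⟨ℓ, by omega⟩ rfl).trans (hmono (Fin.le_def.2 hℓ))))

theorem SupportCriterion'.lt_iff {n : ℕ} {k : Fin n → ℝ} (hmono : Monotone k) {ℓ : ℕ}
    (h : SupportCriterion' k ℓ) (i : Fin n) : (i : ℕ) < ℓ ↔ k i ≤ degreeThreshold k ℓ := by
  obtain ⟨h3, hn, h1, h2⟩ := h
  constructor
  · intro hi
    exact (hmono (show i ≤ ⟨ℓ - 1, by omega⟩ from Fin.le_def.2 (Nat.le_sub_one_of_lt hi))).trans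
      (h1 ⟨ℓ - 1, by omega⟩ (Nat.sub_add_cancel (by omega)))
  · intro hi
    by_contra! hℓ
    exact absurd hi (not_le.2 ((h2 ⟨ℓ, by omega⟩ rfl).trans_le (hmono (Fin.le_def.2 hℓ))))

/-- The criterion makes the inverse threshold a solution of the equation for `t`, hence equal to
`t`. So `ℓ` must be the number of nodes with `t k_i < 1`, which settles existence, uniqueness and
the support together. -/
theorem supportCriterion_iff {n : ℕ} {k : Fin n → ℝ} (hpos : ∀ i, 0 < k i) (hmono : Monotone k)
    (hm : 1 < ∑ i, k i) {t : ℝ} (ht0 : 0 < t) (ht : ∑ i, max 0 (1 - t * k i) = 2) (ℓ : ℕ) :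
    SupportCriterion k ℓ ↔ ℓ ≤ n ∧ ∀ i : Fin n, t * k i < 1 ↔ (i : ℕ) < ℓ := by
  constructor
  · intro h
    refine ⟨h.2.1, fun i => ?_⟩
    have hT := sum_max_injective hpos hm ht (sum_max_inv_degreeThreshold hpos h.1 h.2.1
      (fun i hi => ((h.lt_iff hmono i).1 hi).le)
      (fun i hi => not_lt.1 (mt (h.lt_iff hmono i).2 (not_lt.2 hi))))
    rw [h.lt_iff hmono, hT, inv_mul_lt_one₀ (degreeThreshold_pos hpos h.1 h.2.1)]
  · rintro ⟨hn, h⟩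
    obtain ⟨h3, hT⟩ := degreeThreshold_eq_inv hpos ht0 ht hn (fun i hi => ((h i).2 hi).le)
      (fun i hi => not_lt.1 (mt (h i).1 (not_lt.2 hi)))
    refine ⟨h3, hn, fun i hi => ?_, fun i hi => ?_⟩
    · rw [hT, ← one_div, lt_div_iff₀' ht0]
      exact (h i).2 (by omega)
    · rw [hT, ← one_div, div_le_iff₀' ht0]
      exact not_lt.1 (mt (h i).1 (by omega))

/-- Here `ℓ` also counts the nodes with `t k_i = 1`, which carry no mass. -/
theorem supportCriterion'_iff {n : ℕ} {k : Fin n → ℝ} (hpos : ∀ i, 0 < k i) (hmono : Monotone k)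
    (hm : 1 < ∑ i, k i) {t : ℝ} (ht0 : 0 < t) (ht : ∑ i, max 0 (1 - t * k i) = 2) (ℓ : ℕ) :
    SupportCriterion' k ℓ ↔ ℓ ≤ n ∧ ∀ i : Fin n, t * k i ≤ 1 ↔ (i : ℕ) < ℓ := by
  constructor
  · intro h
    refine ⟨h.2.1, fun i => ?_⟩
    have hT := sum_max_injective hpos hm ht (sum_max_inv_degreeThreshold hpos h.1 h.2.1
      (fun i hi => (h.lt_iff hmono i).1 hi)
      (fun i hi => (not_le.1 (mt (h.lt_iff hmono i).2 (not_lt.2 hi))).le))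
    rw [h.lt_iff hmono, hT, inv_mul_le_one₀ (degreeThreshold_pos hpos h.1 h.2.1)]
  · rintro ⟨hn, h⟩
    obtain ⟨h3, hT⟩ := degreeThreshold_eq_inv hpos ht0 ht hn (fun i hi => (h i).2 hi)
      (fun i hi => (not_le.1 (mt (h i).1 (not_lt.2 hi))).le)
    refine ⟨h3, hn, fun i hi => ?_, fun i hi => ?_⟩
    · rw [hT, ← one_div, le_div_iff₀' ht0]
      exact (h i).2 (by omega)
    · rw [hT, ← one_div, div_lt_iff₀' ht0]
      exact not_le.1 (mt (h i).1 (by omega))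

/-! ### Assembly of the theorem. -/

theorem mainTheorem5 (n : ℕ) (k : Fin n → ℝ) (hpos : ∀ i, 0 < k i) (hmono : Monotone k)
    (hm : 1 < ∑ i, k i) :
    (∀ i j : Fin n, i ≠ j → effectiveResistance (configurationWeights k) i j =
      ((∑ r, k r) - 1) / (∑ r, k r) * ((k i)⁻¹ + (k j)⁻¹)) ∧
    ∃ p : Fin n → ℝ,
      IsMaxVarianceDistribution (configurationWeights k) p ∧
      (∀ q, IsMaxVarianceDistribution (configurationWeights k) q → q = p) ∧
      (3 ≤ n →
        (∃! ℓ : ℕ, SupportCriterion k ℓ) ∧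
        (∀ ℓ : ℕ, SupportCriterion k ℓ → {i | 0 < p i} = {i : Fin n | (i : ℕ) < ℓ}) ∧
        (∃! ℓ : ℕ, SupportCriterion' k ℓ) ∧
        (∀ ℓ : ℕ, SupportCriterion' k ℓ →
          {i | 0 < p i} = {i : Fin n | (i : ℕ) < ℓ ∧ k i < degreeThreshold k ℓ})) ∧
      (n ≤ 2 → {i | 0 < p i} = Set.univ) := by
  refine ⟨fun i j hij => effectiveResistance_configurationWeights hpos hm hij, ?_⟩
  have hne : Nonempty (Fin n) := by
    by_contra h
    rw [not_nonempty_iff] at h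
    rw [Finset.univ_eq_empty, Finset.sum_empty] at hm
    exact absurd hm (by norm_num)
  obtain ⟨t, ht⟩ := exists_sum_max_eq_two hpos
  refine ⟨thresholdDistribution k t, isMaxVarianceDistribution_thresholdDistribution hpos hm ht,
    fun q hq => hq.eq_thresholdDistribution hpos hm ht, fun hn => ?_, fun hn => ?_⟩
  · have ht0 : 0 < t := pos_of_sum_max_eq_two hpos ht (by rwa [Fintype.card_fin])
    have hle : ∀ i j : Fin n, i ≤ j → t * k i ≤ t * k j := fun i j hij =>
      mul_le_mul_of_nonneg_left (hmono hij) ht0.le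
    simp only [thresholdDistribution_pos_iff]
    refine ⟨?_, fun ℓ hℓ => ?_, ?_, fun ℓ hℓ => ?_⟩
    · obtain ⟨ℓ, hℓn, hℓ⟩ := exists_iff_val_lt_of_down_closed (fun i => t * k i < 1)
        fun i j hij hj => (hle i j hij).trans_lt hj
      refine ⟨ℓ, (supportCriterion_iff hpos hmono hm ht0 ht ℓ).2 ⟨hℓn, hℓ⟩, fun ℓ' hℓ' => ?_⟩
      replace hℓ' := (supportCriterion_iff hpos hmono hm ht0 ht ℓ').1 hℓ'
      exact eq_of_forall_val_lt_iff hℓ'.1 hℓn fun i => (hℓ'.2 i).symm.trans (hℓ i)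
    · rw [supportCriterion_iff hpos hmono hm ht0 ht] at hℓ
      exact Set.ext hℓ.2
    · obtain ⟨ℓ, hℓn, hℓ⟩ := exists_iff_val_lt_of_down_closed (fun i => t * k i ≤ 1)
        fun i j hij hj => (hle i j hij).trans hj
      refine ⟨ℓ, (supportCriterion'_iff hpos hmono hm ht0 ht ℓ).2 ⟨hℓn, hℓ⟩, fun ℓ' hℓ' => ?_⟩
      replace hℓ' := (supportCriterion'_iff hpos hmono hm ht0 ht ℓ').1 hℓ'
      exact eq_of_forall_val_lt_iff hℓ'.1 hℓn fun i => (hℓ'.2 i).symm.trans (hℓ i)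
    -- The support loses exactly the ties `k_i = 1/t`, and `1/t` is the threshold at `ℓ`.
    · obtain ⟨hn', h⟩ := (supportCriterion'_iff hpos hmono hm ht0 ht ℓ).1 hℓ
      obtain ⟨-, hT⟩ := degreeThreshold_eq_inv hpos ht0 ht hn' (fun i hi => (h i).2 hi)
        (fun i hi => (not_le.1 (mt (h i).1 (not_lt.2 hi))).le)
      ext i
      simp only [Set.mem_ofPred_eq]
      rw [← h i, hT, ← one_div, lt_div_iff₀' ht0]
      exact ⟨fun hi => ⟨hi.le, hi⟩, fun hi => hi.2⟩
  · refine Set.eq_univ_of_forall fun i => thresholdDistribution_pos_iff.2 ?_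
    exact mul_lt_one_of_sum_max_eq_two hpos ht (by rwa [Fintype.card_fin]) i
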